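/- \textbf{Theorem (convergence of the adaptive ADMM).} Let $M\in\mathbb{R}^{m\times n}$ be a nonzero matrix with matrix $2$-norm $\|M\|$. Let $f:\mathbb{R}^n\to{]-\infty,+\infty]}$ be proper, lower semicontinuous and $\alpha$-convex, and let $g:\mathbb{R}^m\to{]-\infty,+\infty]}$ be proper, lower semicontinuous and $\beta$-convex, where $\alpha,\beta\in\mathbb{R}$ satisfy $\alpha\ge 0$ and $\alpha+\beta\|M\|^2\ge 0$. (A function $h$ is $\rho$-convex if $h-\frac{\rho}{2}\|\cdot\|^2$ is convex.) Consider the problem $$(\mathcal P)\qquad \min\ f(x)+g(z)\quad\text{s.t. } Mx=z .$$ Call $(x,z,y)\in\mathbb{R}^n\times\mathbb{R}^m\times\mathbb{R}^m$ a critical point of the Lagrangian $L_0(x,z,y)=f(x)+g(z)+\langle y,Mx-z\rangle$ if $$-M^Ty\in\partial f(x),\qquad y\in\widehat\partial g(z),\qquad Mx-z=0,$$ where $\partial$ is the convex subdifferential and $\widehat\partial$ the Fr\'echet subdifferential (both empty outside the domain of the function). Assume that $L_0$ has a critical point and that $$0\in\operatorname{ri}\big(\operatorname{dom} f^*-\operatorname{ran}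 M^T\big),$$ where $f^*$ is the Fenchel conjugate of $f$ and $\operatorname{ri}$ denotes the relative interior. Let $\delta>\max\{0,-2\beta\}$ and let $\gamma$ satisfy $$\gamma=\delta+2\beta\quad\text{if }\alpha+\beta\|M\|^2=0,$$ $$\gamma\in\left]\max\{0,\delta+2\beta-\Delta_\delta\},\ \delta+2\beta+\Delta_\delta\right[\quad\text{if }\alpha+\beta\|M\|^2>0,$$ where $\Delta_\delta:=\frac{1}{\|M\|}\sqrt{2(\alpha+\beta\|M\|^2)(\delta+2\beta)}$. From an arbitrary initial point $(x^0,z^0,y^0)\in\mathbb{R}^n\times\mathbb{R}^m\times\mathbb{R}^m$, the adaptive ADMM iterates, for $k=0,1,2,\ldots$, $$x^{k+1}\in\operatorname*{argmin}_{x\in\mathbb{R}^n}\Big\{f(x)+\tfrac{\gamma}{2}\big\|Mx-z^k+\tfrac{1}{\gamma}y^k\big\|^2\Big\},$$ $$z^{k+1}\in\operatorname*{argmin}_{z\in\mathbb{R}^m}\Big\{g(z)+\tfrac{\delta}{2}\big\|Mx^{k+1}-z+\tfrac{1}{\delta}y^k\big\|^2\Big\},$$ $$y^{k+1}=y^k+\delta(Mx^{k+1}-z^{k+1}).$$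 Then the iteration is well defined: for all $(z^k,y^k)$ the first $\operatorname{argmin}$ is nonempty, and for all $(x^{k+1},y^k)$ the second one is a singleton. Moreover, for every sequence $(x^k,z^k,y^k)_k$ generated in this way, there is a critical point $(x^\star,z^\star,y^\star)$ of $L_0$ such that $$Mx^k\to Mx^\star,\qquad z^k\to z^\star,\qquad y^k\to y^\star,$$ and $(x^\star,z^\star)$ is a solution of $(\mathcal P)$. -/

import Mathlib

open scoped Topology Pointwise Matrix.Norms.L2Operator

noncomputable section

namespace AADMM

/-- The Euclidean space of dimension `d`. -/
abbrev E (d : ℕ) : Type := EuclideanSpace ℝ (Fin d)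

/-- The linear map `x ↦ M x` between Euclidean spaces given by the matrix `M`. -/
abbrev app {m n : ℕ} (M : Matrix (Fin m) (Fin n) ℝ) (x : E n) : E m :=
  Matrix.toEuclideanLin M x

/-- The effective domain `{x | φ x < +∞}`. -/
def effDom {d : ℕ} (φ : E d → EReal) : Set (E d) := {x | φ x < ⊤}

/-- `φ` takes values in `]-∞, +∞]` and has a nonempty effective domain. -/
def IsProper {d : ℕ} (φ : E d → EReal) : Prop :=
  (∀ x, φ x ≠ ⊥) ∧ (effDom φ).Nonempty

/-- `α`-convexity of a function with values in `]-∞, +∞]`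
(with the convention `0 * (+∞) = 0`, which holds in `EReal`). -/
def IsAlphaConvex {d : ℕ} (α : ℝ) (φ : E d → EReal) : Prop :=
  ∀ x y : E d, ∀ t : ℝ, 0 ≤ t → t ≤ 1 →
    φ ((1 - t) • x + t • y) ≤
      ((1 - t : ℝ) : EReal) * φ x + (t : EReal) * φ y
        - ((α / 2 * t * (1 - t) * ‖x - y‖ ^ 2 : ℝ) : EReal)

/-- The convex subdifferential; it is empty outside the effective domain. -/
def subdiff {d : ℕ} (φ : E d → EReal) (x : E d) : Set (E d) :=
  {u | x ∈ effDom φ ∧ ∀ y : E d, ((inner ℝ (y - x) u : ℝ) : EReal) + φ x ≤ φ y}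

/-- The Fréchet subdifferential; it is empty outside the effective domain. -/
def frechetSubdiff {d : ℕ} (φ : E d → EReal) (x : E d) : Set (E d) :=
  {u | x ∈ effDom φ ∧
    0 ≤ Filter.liminf
      (fun y : E d => (φ y - φ x - ((inner ℝ u (y - x) : ℝ) : EReal)) / ((‖y - x‖ : ℝ) : EReal))
      (𝓝[≠] x)}

/-- The Fenchel conjugate. -/
def conj {d : ℕ} (φ : E d → EReal) (u : E d) : EReal :=
  ⨆ x : E d, ((inner ℝ u x : ℝ) : EReal) - φ x

/-- The set of global minimizers. -/
def argmin {d : ℕ} (φ : E d → EReal) : Set (E d) := {x | ∀ x', φ x ≤ φ x'}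

/-- `(x, z)` solves: minimize `f x + g z` subject to `M x = z`. -/
def IsSolution {n m : ℕ} (f : E n → EReal) (g : E m → EReal) (M : Matrix (Fin m) (Fin n) ℝ)
    (x : E n) (z : E m) : Prop :=
  app M x = z ∧ ∀ (x' : E n) (z' : E m), app M x' = z' → f x + g z ≤ f x' + g z'

/-- `(x, z, y)` is a critical point of the Lagrangian
`L₀ (x, z, y) = f x + g z + ⟪y, M x - z⟫`. -/
def IsCriticalPoint {n m : ℕ} (f : E n → EReal) (g : E m → EReal)
    (M : Matrix (Fin m) (Fin n) ℝ) (x : E n) (z : E m) (y : E m) : Prop :=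
  -(app M.transpose y) ∈ subdiff f x ∧ y ∈ frechetSubdiff g z ∧ app M x - z = 0

/-- The set of possible `x`-updates from `(z, y)`. The objective is the augmented Lagrangian
`L_γ (·, z, y)` up to the terms which do not depend on its variable. -/
def xUpdate {n m : ℕ} (f : E n → EReal) (M : Matrix (Fin m) (Fin n) ℝ) (γ : ℝ)
    (z y : E m) : Set (E n) :=
  argmin fun x => f x + ((γ / 2 * ‖app M x - z + γ⁻¹ • y‖ ^ 2 : ℝ) : EReal)

/-- The set of possible `z`-updates from `(x, y)`. The objective is the augmented Lagrangian
`L_δ (x, ·, y)` up to the terms which do not depend on its variable. -/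
def zUpdate {n m : ℕ} (g : E m → EReal) (M : Matrix (Fin m) (Fin n) ℝ) (δ : ℝ)
    (x : E n) (y : E m) : Set (E m) :=
  argmin fun z => g z + ((δ / 2 * ‖app M x - z + δ⁻¹ • y‖ ^ 2 : ℝ) : EReal)

/-- The sequence `(x k, z k, y k)` is generated by the adaptive ADMM with parameters `γ, δ`,
from the initial point `(x 0, z 0, y 0)`. -/
def IsAADMM {n m : ℕ} (f : E n → EReal) (g : E m → EReal) (M : Matrix (Fin m) (Fin n) ℝ)
    (γ δ : ℝ) (x : ℕ → E n) (z y : ℕ → E m) : Prop :=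
  ∀ k, x (k + 1) ∈ xUpdate f M γ (z k) (y k) ∧
    z (k + 1) ∈ zUpdate g M δ (x (k + 1)) (y k) ∧
    y (k + 1) = y k + δ • (app M (x (k + 1)) - z (k + 1))

/-- The half-length `Δ_δ` of the parameter interval; `‖M‖` is the matrix `2`-norm. -/
def halfWidth {n m : ℕ} (M : Matrix (Fin m) (Fin n) ℝ) (α β δ : ℝ) : ℝ :=
  1 / ‖M‖ * Real.sqrt (2 * (α + β * ‖M‖ ^ 2) * (δ + 2 * β))

end AADMM

end

/-!
The proof is a direct energy argument. Write `a = M x⁺` for the image of the first update computed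
from `(z, y)` and consider the shadow variable `w = y + δ z`, which the iteration maps to
`w⁺ = y + δ a`. The optimality conditions of the two updates say that `-Mᵀ (y + γ (a - z))` is an
`α`-subgradient of `f` and that `y` is a `β`-subgradient of `g` at `z`, where a `ρ`-subgradient
(`AADMM.IsSubgradient`) includes the quadratic term `ρ / 2 * ‖·‖ ^ 2`; for `ρ`-convex functions
these are exactly the Fréchet subgradients. Inserting the two monotonicity inequalities with respect
to a critical point `(x⋆, z⋆, y⋆)` into the expansion of `‖w⁺ - w⋆‖ ^ 2` yields
`‖w⁺ - w⋆‖ ^ 2 ≤ ‖w - w⋆‖ ^ 2 - δ Q (a - z⋆, z - z⋆)` with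
`Q (a, z) = (2 γ + 2 τ - η) ‖a‖ ^ 2 - 2 γ ⟪a, z⟫ + η ‖z‖ ^ 2`, where `τ = α / ‖M‖ ^ 2 + β` and
`η = δ + 2 β`. The admissible range of `γ` is precisely what makes `Q` dominate a positive multiple
of `‖a - z‖ ^ 2` (`AADMM.exists_mul_norm_sub_sq_le_form`, `AADMM.norm_shadow_sub_sq_le`).

Hence `w` is Fejér monotone with respect to the critical points and `a - z → 0`. Since `z` depends
on `w` in a Lipschitz way, `(z, y)` is bounded and has a cluster point `(z̄, ȳ)`. The primal iterates
need not be bounded, but an `x`-update `x̄` at the cluster point exists, and monotonicity of the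
subdifferential of `f` forces `M x̄ = z̄`. So the cluster point belongs to a critical point, and Fejér
monotonicity upgrades the subsequence to the whole sequence
(`AADMM.exists_tendsto_of_isSubgradient`).

The qualification condition enters only through the existence of the `x`-update
(`AADMM.xUpdate_nonempty`). The objective is regularized by `ε / 2 * ‖x‖ ^ 2`; by Fermat's rule the
negative of `ε` times the regularized minimizer lies in `dom f* - ran Mᵀ`, hence the minimizer lies
in the span of that set. There the qualification condition and the Fenchel–Young inequality bound
every linear functional of the minimizers, and a limit point as `ε → 0` is the required update.
-/

namespace AADMM

open Filter

/-! ### Extended-real-valued functions on their effective domain -/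

section

variable {d : ℕ} {φ : E d → EReal}

lemma IsProper.coe_toReal (hp : IsProper φ) {x : E d} (hx : x ∈ effDom φ) :
    ((φ x).toReal : EReal) = φ x :=
  EReal.coe_toReal (ne_of_lt hx) (hp.1 x)

lemma IsAlphaConvex.segment {ρ : ℝ} (hp : IsProper φ) (hc : IsAlphaConvex ρ φ) {x y : E d}
    (hx : x ∈ effDom φ) (hy : y ∈ effDom φ) {t : ℝ} (h0 : 0 ≤ t) (h1 : t ≤ 1) :
    x + t • (y - x) ∈ effDom φ ∧
      (φ (x + t • (y - x))).toReal ≤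
        (1 - t) * (φ x).toReal + t * (φ y).toReal - ρ / 2 * t * (1 - t) * ‖y - x‖ ^ 2 := by
  have h := hc x y t h0 h1
  rw [show (1 - t) • x + t • y = x + t • (y - x) by module, ← hp.coe_toReal hx,
    ← hp.coe_toReal hy, norm_sub_rev x y] at h
  norm_cast at h
  have hmem : x + t • (y - x) ∈ effDom φ := lt_of_le_of_lt h (EReal.coe_lt_top _)
  rw [← hp.coe_toReal hmem] at h
  exact ⟨hmem, EReal.coe_le_coe_iff.1 h⟩

lemma IsProper.mem_argmin_add_coe_iff (hp : IsProper φ) {q : E d → ℝ} {x : E d} :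
    x ∈ argmin (fun y => φ y + (q y : EReal)) ↔
      x ∈ effDom φ ∧ ∀ y ∈ effDom φ, (φ x).toReal + q x ≤ (φ y).toReal + q y := by
  constructor
  · intro h
    have hx : x ∈ effDom φ := by
      obtain ⟨x₀, hx₀⟩ := hp.2
      have h1 : φ x + (q x : EReal) ≤ φ x₀ + (q x₀ : EReal) := h x₀
      rw [← hp.coe_toReal hx₀] at h1
      norm_cast at h1
      have h2 := lt_of_le_of_lt h1 (EReal.coe_lt_top _)
      change φ x < ⊤
      rw [lt_top_iff_ne_top]
      intro h3
      simp [h3] at h2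
    refine ⟨hx, fun y hy => ?_⟩
    have h1 : φ x + (q x : EReal) ≤ φ y + (q y : EReal) := h y
    rw [← hp.coe_toReal hx, ← hp.coe_toReal hy] at h1
    exact_mod_cast h1
  · rintro ⟨hx, h⟩ y
    by_cases hy : y ∈ effDom φ
    · have h1 := h y hy
      simp only
      rw [← hp.coe_toReal hx, ← hp.coe_toReal hy]
      exact_mod_cast h1
    · have : φ y = ⊤ := by simpa [effDom] using hy
      simp [this]

/-- Upper bounds along a sequence pass to the limit for lower semicontinuous functions. -/
lemma _root_.LowerSemicontinuous.le_of_tendsto {X : Type*} [TopologicalSpace X] {ψ : X → EReal}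
    (hl : LowerSemicontinuous ψ) {u : ℕ → X} {a : X} {r : ℕ → ℝ} {b : ℝ}
    (hu : Tendsto u atTop (𝓝 a)) (hr : Tendsto r atTop (𝓝 b))
    (h : ∀ᶠ k in atTop, ψ (u k) ≤ (r k : EReal)) : ψ a ≤ (b : EReal) := by
  by_contra! hlt
  obtain ⟨c, hc1, hc2⟩ := EReal.lt_iff_exists_real_btwn.1 hlt
  have h1 : ∀ᶠ k in atTop, c < r k := by
    filter_upwards [hu.eventually (hl a c hc2), h] with k hk1 hk2
    exact EReal.coe_lt_coe_iff.1 (hk1.trans_le hk2)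
  exact absurd (EReal.coe_lt_coe_iff.1 hc1)
    (not_lt.2 (ge_of_tendsto hr (h1.mono fun _ hk => hk.le)))

/-! ### Subgradients with a quadratic term -/

/-- `u` is a `ρ`-subgradient of `φ` at `x`: the point `x` lies in the effective domain and
`φ ≥ φ x + ⟪u, · - x⟫ + ρ / 2 * ‖· - x‖ ^ 2`. The inequality is written with real values, hence
only on the effective domain; elsewhere it is trivial. -/
def IsSubgradient (ρ : ℝ) (φ : E d → EReal) (x u : E d) : Prop :=
  x ∈ effDom φ ∧ ∀ y ∈ effDom φ,
    (φ x).toReal + inner ℝ u (y - x) + ρ / 2 * ‖y - x‖ ^ 2 ≤ (φ y).toReal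

/-- The `ρ`-subdifferential of any function is `ρ`-monotone. -/
lemma IsSubgradient.monotone {ρ : ℝ} {x x' u u' : E d} (h : IsSubgradient ρ φ x u)
    (h' : IsSubgradient ρ φ x' u') : ρ * ‖x - x'‖ ^ 2 ≤ inner ℝ (u - u') (x - x') := by
  have h1 := h.2 x' h'.1
  have h2 := h'.2 x h.1
  rw [norm_sub_rev, ← neg_sub x x', inner_neg_right] at h1
  rw [inner_sub_left]
  linarith

/-- For a `ρ`-convex function, a first-order lower bound along rays already gives the global
quadratic minorant. -/
lemma IsAlphaConvex.isSubgradient {ρ : ℝ} (hp : IsProper φ) (hc : IsAlphaConvex ρ φ) {x u : E d}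
    (hx : x ∈ effDom φ)
    (h : ∀ v : E d, x + v ∈ effDom φ → ∀ ε > 0, ∀ᶠ t in 𝓝[>] (0 : ℝ),
      (φ x).toReal + t * inner ℝ u v - ε * t ≤ (φ (x + t • v)).toReal) :
    IsSubgradient ρ φ x u := by
  refine ⟨hx, fun y hy => le_of_forall_pos_le_add fun ε hε => ?_⟩
  have h1 := h (y - x) (by simpa using hy) ε hε
  have h2 : ∀ᶠ t in 𝓝[>] (0 : ℝ), (φ x).toReal + inner ℝ u (y - x)
      + ρ / 2 * (1 - t) * ‖y - x‖ ^ 2 ≤ (φ y).toReal + ε := by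
    filter_upwards [h1, Ioo_mem_nhdsGT (zero_lt_one (α := ℝ))] with t ht htI
    have h3 := (hc.segment hp hx hy htI.1.le htI.2.le).2
    refine le_of_mul_le_mul_left ?_ htI.1
    linarith
  have h4 : Tendsto (fun t : ℝ => (φ x).toReal + inner ℝ u (y - x)
      + ρ / 2 * (1 - t) * ‖y - x‖ ^ 2) (𝓝[>] 0)
      (𝓝 ((φ x).toReal + inner ℝ u (y - x) + ρ / 2 * (1 - 0) * ‖y - x‖ ^ 2)) :=
    (Continuous.tendsto (by fun_prop) 0).mono_left nhdsWithin_le_nhds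
  simpa using le_of_tendsto h4 h2

/-- Fermat's rule for the sum of a `ρ`-convex function and a function with a quadratic upper
bound along rays. -/
lemma IsAlphaConvex.isSubgradient_of_mem_argmin {ρ : ℝ} (hp : IsProper φ)
    (hc : IsAlphaConvex ρ φ) {q : E d → ℝ} {x u : E d}
    (hx : x ∈ argmin (fun y => φ y + (q y : EReal)))
    (hq : ∀ v : E d, ∃ C : ℝ, ∀ t : ℝ, q (x + t • v) ≤ q x - t * inner ℝ u v + C * t ^ 2) :
    IsSubgradient ρ φ x u := by
  rw [hp.mem_argmin_add_coe_iff] at hx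
  refine hc.isSubgradient hp hx.1 fun v hv ε hε => ?_
  obtain ⟨C, hC⟩ := hq v
  have h1 : ∀ᶠ t in 𝓝[>] (0 : ℝ), C * t < ε := by
    have : Tendsto (fun t : ℝ => C * t) (𝓝[>] 0) (𝓝 (C * 0)) :=
      (Continuous.tendsto (by fun_prop) 0).mono_left nhdsWithin_le_nhds
    exact this.eventually_lt_const (by simpa using hε)
  filter_upwards [h1, Ioo_mem_nhdsGT (zero_lt_one (α := ℝ))] with t ht htI
  have h2 := (hc.segment hp hx.1 hv htI.1.le htI.2.le).1
  rw [add_sub_cancel_left] at h2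
  have h3 := hx.2 _ h2
  have h4 := hC t
  have h5 : C * t ^ 2 ≤ ε * t := by
    have := mul_le_mul_of_nonneg_right ht.le htI.1.le
    nlinarith
  linarith

lemma IsAlphaConvex.mem_subdiff_iff {ρ : ℝ} (hp : IsProper φ) (hc : IsAlphaConvex ρ φ)
    (hρ : 0 ≤ ρ) {x u : E d} : u ∈ subdiff φ x ↔ IsSubgradient ρ φ x u := by
  constructor
  · rintro ⟨hx, h⟩
    refine hc.isSubgradient hp hx fun v hv ε hε => ?_
    filter_upwards [Ioo_mem_nhdsGT (zero_lt_one (α := ℝ))] with t ht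
    have h2 := (hc.segment hp hx hv ht.1.le ht.2.le).1
    rw [add_sub_cancel_left] at h2
    have h1 := h (x + t • v)
    rw [← hp.coe_toReal hx, ← hp.coe_toReal h2, add_sub_cancel_left, real_inner_smul_left,
      real_inner_comm] at h1
    have h3 : t * inner ℝ u v + (φ x).toReal ≤ (φ (x + t • v)).toReal := by exact_mod_cast h1
    nlinarith [mul_pos hε ht.1]
  · rintro ⟨hx, h⟩
    refine ⟨hx, fun y => ?_⟩
    by_cases hy : y ∈ effDom φ
    · have h1 := h y hy
      rw [← hp.coe_toReal hx, ← hp.coe_toReal hy, real_inner_comm]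
      have : inner ℝ u (y - x) + (φ x).toReal ≤ (φ y).toReal := by
        have : 0 ≤ ρ / 2 * ‖y - x‖ ^ 2 := by positivity
        linarith
      exact_mod_cast this
    · have : φ y = ⊤ := by simpa [effDom] using hy
      simp [this]

/-- For a `ρ`-convex function, with `ρ` of any sign, the Fréchet subgradients are exactly the
`ρ`-subgradients. -/
lemma IsAlphaConvex.mem_frechetSubdiff_iff {ρ : ℝ} (hp : IsProper φ) (hc : IsAlphaConvex ρ φ)
    {x u : E d} : u ∈ frechetSubdiff φ x ↔ IsSubgradient ρ φ x u := by
  constructor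
  · rintro ⟨hx, h⟩
    refine hc.isSubgradient hp hx fun v hv ε hε => ?_
    rcases eq_or_ne v 0 with rfl | hv0
    · filter_upwards [self_mem_nhdsWithin] with t ht
      simpa using (mul_pos hε ht).le
    have hvn : 0 < ‖v‖ := norm_pos_iff.2 hv0
    have h1 : ∀ᶠ y in 𝓝[≠] x, ((-(ε / ‖v‖) : ℝ) : EReal) <
        (φ y - φ x - ((inner ℝ u (y - x) : ℝ) : EReal)) / ((‖y - x‖ : ℝ) : EReal) := by
      refine eventually_lt_of_lt_liminf (lt_of_lt_of_le ?_ h)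
      have : -(ε / ‖v‖) < 0 := by simpa using div_pos hε hvn
      exact_mod_cast this
    have h2 : Tendsto (fun t : ℝ => x + t • v) (𝓝[>] 0) (𝓝[≠] x) := by
      refine tendsto_nhdsWithin_iff.2 ⟨?_, ?_⟩
      · have : Tendsto (fun t : ℝ => x + t • v) (𝓝 0) (𝓝 (x + (0 : ℝ) • v)) :=
          Continuous.tendsto (by fun_prop) 0
        simpa using this.mono_left nhdsWithin_le_nhds
      · filter_upwards [self_mem_nhdsWithin] with t ht
        simpa [hv0] using (ne_of_gt ht)
    filter_upwards [h2.eventually h1, Ioo_mem_nhdsGT (zero_lt_one (α := ℝ))] with t ht htI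
    have h3 := (hc.segment hp hx hv htI.1.le htI.2.le).1
    rw [add_sub_cancel_left] at h3
    rw [← hp.coe_toReal hx, ← hp.coe_toReal h3, add_sub_cancel_left, norm_smul,
      Real.norm_of_nonneg htI.1.le, real_inner_smul_right] at ht
    have h4 : -(ε / ‖v‖) < ((φ (x + t • v)).toReal - (φ x).toReal - t * inner ℝ u v)
        / (t * ‖v‖) := by
      rw [← EReal.coe_lt_coe_iff, EReal.coe_div]
      exact_mod_cast ht
    rw [lt_div_iff₀ (mul_pos htI.1 hvn)] at h4
    have h5 : -(ε / ‖v‖) * (t * ‖v‖) = -(ε * t) := by field_simp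
    linarith
  · rintro ⟨hx, h⟩
    refine ⟨hx, ?_⟩
    -- The difference quotient is bounded below by `ρ / 2 * ‖y - x‖`, which tends to `0`.
    refine le_of_forall_lt fun c hc => ?_
    obtain ⟨r, hr1, hr2⟩ := EReal.lt_iff_exists_real_btwn.1 hc
    refine hr1.trans_le (le_liminf_of_le (by isBoundedDefault) ?_)
    have hr : r < 0 := by exact_mod_cast hr2
    have h1 : ∀ᶠ y in 𝓝[≠] x, r < ρ / 2 * ‖y - x‖ := by
      have : Tendsto (fun y : E d => ρ / 2 * ‖y - x‖) (𝓝[≠] x) (𝓝 (ρ / 2 * ‖x - x‖)) :=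
        (Continuous.tendsto (by fun_prop) x).mono_left nhdsWithin_le_nhds
      exact this.eventually_const_lt (by simpa using hr)
    filter_upwards [h1, self_mem_nhdsWithin] with y hy hyx
    have hn : 0 < ‖y - x‖ := norm_pos_iff.2 (sub_ne_zero.2 hyx)
    rw [← hp.coe_toReal hx]
    by_cases hyD : y ∈ effDom φ
    · have h2 := h y hyD
      rw [← hp.coe_toReal hyD]
      have : r ≤ ((φ y).toReal - (φ x).toReal - inner ℝ u (y - x)) / ‖y - x‖ := by
        rw [le_div_iff₀ hn]
        nlinarith
      rw [← EReal.coe_le_coe_iff, EReal.coe_div] at this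
      exact_mod_cast this
    · have : φ y = ⊤ := by simpa [effDom] using hyD
      rw [this, EReal.top_sub_coe, EReal.top_sub_coe,
        EReal.top_div_of_pos_ne_top (by exact_mod_cast hn) (EReal.coe_ne_top _)]
      exact le_top

/-- The graph of the `ρ`-subdifferential of a lower semicontinuous function is closed. -/
lemma IsSubgradient.of_tendsto {ρ : ℝ} (hp : IsProper φ) (hl : LowerSemicontinuous φ)
    {x u : ℕ → E d} {a b : E d} (hx : Tendsto x atTop (𝓝 a)) (hu : Tendsto u atTop (𝓝 b))
    (h : ∀ᶠ k in atTop, IsSubgradient ρ φ (x k) (u k)) : IsSubgradient ρ φ a b := by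
  have key : ∀ y ∈ effDom φ,
      φ a ≤ (((φ y).toReal - inner ℝ b (y - a) - ρ / 2 * ‖y - a‖ ^ 2 : ℝ) : EReal) := by
    intro y hy
    refine hl.le_of_tendsto hx (r := fun k => (φ y).toReal - inner ℝ (u k) (y - x k)
      - ρ / 2 * ‖y - x k‖ ^ 2) ?_ ?_
    · exact (tendsto_const_nhds.sub (hu.inner (tendsto_const_nhds.sub hx))).sub
        (((tendsto_const_nhds.sub hx).norm.pow 2).const_mul _)
    · filter_upwards [h] with k hk
      have := hk.2 y hy
      rw [← hp.coe_toReal hk.1, EReal.coe_le_coe_iff]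
      linarith
  obtain ⟨x₀, hx₀⟩ := hp.2
  have ha : a ∈ effDom φ := lt_of_le_of_lt (key x₀ hx₀) (EReal.coe_lt_top _)
  refine ⟨ha, fun y hy => ?_⟩
  have := key y hy
  rw [← hp.coe_toReal ha, EReal.coe_le_coe_iff] at this
  linarith

/-- Weierstrass' theorem for the sum of a function with a `ρ`-subgradient and a continuous
function growing at least like `κ / 2 * ‖· - c‖ ^ 2`, where `ρ + κ > 0`. -/
lemma IsSubgradient.argmin_add_nonempty {ρ κ : ℝ} (hp : IsProper φ)
    (hl : LowerSemicontinuous φ) {x₀ u₀ : E d} (h : IsSubgradient ρ φ x₀ u₀) {q : E d → ℝ}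
    (hqc : Continuous q) {c : E d} (hq : ∀ y, κ / 2 * ‖y - c‖ ^ 2 ≤ q y) (hκ : 0 < ρ + κ) :
    (argmin fun y => φ y + (q y : EReal)).Nonempty := by
  set v : E d := u₀ + κ • (x₀ - c) with hv
  set s := ρ + κ with hs
  set A := |(φ x₀).toReal + q x₀ - ((φ x₀).toReal + κ / 2 * ‖x₀ - c‖ ^ 2)| with hA
  set R : ℝ := 1 + 2 * (‖v‖ + A + 1) / s with hR
  have hA0 : 0 ≤ A := abs_nonneg _
  have hR1 : 1 ≤ R := by
    have : 0 ≤ 2 * (‖v‖ + A + 1) / s := by positivity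
    linarith
  have hlsc : LowerSemicontinuous fun y => φ y + (q y : EReal) := by
    refine hl.add' (continuous_coe_real_ereal.comp hqc).lowerSemicontinuous fun x => ?_
    exact EReal.continuousAt_add (.inr (EReal.coe_ne_bot _)) (.inl (hp.1 x))
  obtain ⟨a, -, hmin⟩ := LowerSemicontinuousOn.exists_isMinOn (s := Metric.closedBall x₀ R)
    ⟨x₀, Metric.mem_closedBall_self (by linarith)⟩ (isCompact_closedBall x₀ R)
    (hlsc.lowerSemicontinuousOn _)
  refine ⟨a, fun y => ?_⟩
  by_cases hy : y ∈ Metric.closedBall x₀ R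
  · exact hmin hy
  -- Outside the ball the quadratic minorant exceeds the value at `x₀`.
  refine (hmin (Metric.mem_closedBall_self (x := x₀) (ε := R) (by linarith))).trans ?_
  by_cases hyD : y ∈ effDom φ
  · have h1 := h.2 y hyD
    have h2 := hq y
    have hr : R < ‖y - x₀‖ := by simpa [dist_eq_norm] using hy
    have h3 : ‖y - c‖ ^ 2 = ‖y - x₀‖ ^ 2 + 2 * inner ℝ (x₀ - c) (y - x₀) + ‖x₀ - c‖ ^ 2 := by
      rw [show y - c = (y - x₀) + (x₀ - c) by abel, norm_add_sq_real, real_inner_comm]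
    have h4 : inner ℝ v (y - x₀) = inner ℝ u₀ (y - x₀) + κ * inner ℝ (x₀ - c) (y - x₀) := by
      rw [hv, inner_add_left, real_inner_smul_left]
    have h5 : -(‖v‖ * ‖y - x₀‖) ≤ inner ℝ v (y - x₀) :=
      (abs_le.1 (abs_real_inner_le_norm v (y - x₀))).1
    have h6 : ‖v‖ + A + 1 ≤ s / 2 * ‖y - x₀‖ := by
      have : 2 * (‖v‖ + A + 1) / s ≤ ‖y - x₀‖ := by linarith
      rw [div_le_iff₀ hκ] at this
      linarith
    have h7 : A ≤ (s / 2 * ‖y - x₀‖ - ‖v‖) * ‖y - x₀‖ := by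
      have h8 : 1 ≤ ‖y - x₀‖ := by linarith
      nlinarith
    have h9 := le_abs_self ((φ x₀).toReal + q x₀ - ((φ x₀).toReal + κ / 2 * ‖x₀ - c‖ ^ 2))
    have h10 : (φ x₀).toReal + q x₀ ≤ (φ y).toReal + q y := by
      rw [← hA] at h9
      have : s / 2 * ‖y - x₀‖ ^ 2 = ρ / 2 * ‖y - x₀‖ ^ 2 + κ / 2 * ‖y - x₀‖ ^ 2 := by
        rw [hs]; ring
      rw [h3] at h2
      nlinarith
    simp only
    rw [← hp.coe_toReal h.1, ← hp.coe_toReal hyD]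
    exact_mod_cast h10
  · have : φ y = ⊤ := by simpa [effDom] using hyD
    simp [this]

end

/-! ### The two update steps -/

section Updates

variable {n m : ℕ} {f : E n → EReal} {g : E m → EReal} {M : Matrix (Fin m) (Fin n) ℝ}
  {α β γ δ : ℝ}

lemma inner_app_transpose (M : Matrix (Fin m) (Fin n) ℝ) (x : E n) (y : E m) :
    inner ℝ (app M.transpose y) x = inner ℝ y (app M x) := by
  have h : app M.transpose y = LinearMap.adjoint (Matrix.toEuclideanLin M) y := by
    rw [← Matrix.toEuclideanLin_conjTranspose_eq_adjoint,
      Matrix.conjTranspose_eq_transpose_of_trivial]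
  rw [h, LinearMap.adjoint_inner_left]

lemma norm_app_le (M : Matrix (Fin m) (Fin n) ℝ) (x : E n) : ‖app M x‖ ≤ ‖M‖ * ‖x‖ :=
  Matrix.l2_opNorm_mulVec M x

lemma continuous_app (M : Matrix (Fin m) (Fin n) ℝ) : Continuous fun x : E n => app M x :=
  (Matrix.toEuclideanLin M).continuous_of_finiteDimensional

/-- The penalty term of the `x`-update is quadratic along every line. -/
lemma xPenalty_add_smul (M : Matrix (Fin m) (Fin n) ℝ) (hγ : γ ≠ 0) (x v : E n) (z y : E m)
    (t : ℝ) :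
    γ / 2 * ‖app M (x + t • v) - z + γ⁻¹ • y‖ ^ 2 = γ / 2 * ‖app M x - z + γ⁻¹ • y‖ ^ 2
      + t * inner ℝ (app M.transpose (y + γ • (app M x - z))) v
      + γ / 2 * ‖app M v‖ ^ 2 * t ^ 2 := by
  have hlin : app M (x + t • v) = app M x + t • app M v := by simp only [app, map_add, map_smul]
  rw [hlin, show app M x + t • app M v - z + γ⁻¹ • y
      = (app M x - z + γ⁻¹ • y) + t • app M v by abel, norm_add_sq_real, norm_smul, mul_pow,
    Real.norm_eq_abs, sq_abs, inner_app_transpose, real_inner_smul_right,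
    show y + γ • (app M x - z) = γ • (app M x - z + γ⁻¹ • y) by
      rw [smul_add, smul_inv_smul₀ hγ, add_comm], real_inner_smul_left]
  ring

lemma isSubgradient_of_mem_xUpdate (hp : IsProper f) (hc : IsAlphaConvex α f) (hγ : γ ≠ 0)
    {x : E n} {z y : E m} (hx : x ∈ xUpdate f M γ z y) :
    IsSubgradient α f x (-app M.transpose (y + γ • (app M x - z))) := by
  refine hc.isSubgradient_of_mem_argmin hp hx fun v => ⟨γ / 2 * ‖app M v‖ ^ 2, fun t => ?_⟩
  rw [xPenalty_add_smul M hγ, inner_neg_left]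
  linarith

lemma isSubgradient_of_mem_zUpdate (hp : IsProper g) (hc : IsAlphaConvex β g) (hδ : δ ≠ 0)
    {x : E n} {z y : E m} (hz : z ∈ zUpdate g M δ x y) :
    IsSubgradient β g z (y + δ • (app M x - z)) := by
  refine hc.isSubgradient_of_mem_argmin hp hz fun v => ⟨δ / 2 * ‖v‖ ^ 2, fun t => ?_⟩
  rw [show app M x - (z + t • v) + δ⁻¹ • y = (app M x - z + δ⁻¹ • y) - t • v by abel,
    norm_sub_sq_real, norm_smul, mul_pow, Real.norm_eq_abs, sq_abs, real_inner_smul_right,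
    show y + δ • (app M x - z) = δ • (app M x - z + δ⁻¹ • y) by
      rw [smul_add, smul_inv_smul₀ hδ, add_comm], real_inner_smul_left]
  linarith

lemma existsUnique_zUpdate (hp : IsProper g) (hl : LowerSemicontinuous g)
    (hc : IsAlphaConvex β g) (hδ : δ ≠ 0) (hβδ : 0 < β + δ) {z₀ u₀ : E m}
    (h₀ : IsSubgradient β g z₀ u₀) (x : E n) (y : E m) :
    ∃! z, z ∈ zUpdate g M δ x y := by
  obtain ⟨z, hz⟩ := h₀.argmin_add_nonempty (κ := δ) (c := app M x + δ⁻¹ • y)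
    (q := fun z => δ / 2 * ‖app M x - z + δ⁻¹ • y‖ ^ 2) hp hl (by fun_prop)
    (fun z => by rw [norm_sub_rev, sub_add_eq_add_sub]) hβδ
  refine ⟨z, hz, fun z' hz' => ?_⟩
  have h := (isSubgradient_of_mem_zUpdate hp hc hδ hz').monotone
    (isSubgradient_of_mem_zUpdate hp hc hδ hz)
  rw [show y + δ • (app M x - z') - (y + δ • (app M x - z)) = -(δ • (z' - z)) by module,
    inner_neg_left, real_inner_smul_left, real_inner_self_eq_norm_sq] at h
  have h1 : ‖z' - z‖ ^ 2 = 0 := by nlinarith [sq_nonneg ‖z' - z‖]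
  exact sub_eq_zero.1 (norm_eq_zero.1 (pow_eq_zero_iff two_ne_zero |>.1 h1))

end Updates

/-! ### Existence of the first update under the qualification condition -/

section Existence

variable {n m : ℕ} {f : E n → EReal} {M : Matrix (Fin m) (Fin n) ℝ} {α γ : ℝ}

/-- Fenchel–Young inequality with a real constant. -/
lemma exists_inner_le_of_mem_effDom_conj (hp : IsProper f) {u : E n}
    (hu : u ∈ effDom (conj f)) :
    ∃ c : ℝ, ∀ x ∈ effDom f, inner ℝ u x ≤ (f x).toReal + c := by
  obtain ⟨c, hc, -⟩ := EReal.lt_iff_exists_real_btwn.1 (show conj f u < ⊤ from hu)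
  refine ⟨c, fun x hx => ?_⟩
  have h := (le_iSup (fun x : E n => ((inner ℝ u x : ℝ) : EReal) - f x) x).trans hc.le
  rw [← hp.coe_toReal hx] at h
  have h' : inner ℝ u x - (f x).toReal ≤ c := by exact_mod_cast h
  linarith

lemma IsSubgradient.mem_effDom_conj (hp : IsProper f) (hα : 0 ≤ α) {x u : E n}
    (h : IsSubgradient α f x u) : u ∈ effDom (conj f) := by
  refine lt_of_le_of_lt (iSup_le fun y => ?_) (EReal.coe_lt_top (inner ℝ u x - (f x).toReal))
  by_cases hy : y ∈ effDom f
  · have h1 := h.2 y hy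
    have h2 : 0 ≤ α / 2 * ‖y - x‖ ^ 2 := by positivity
    rw [inner_sub_right] at h1
    have h3 : inner ℝ u y - (f y).toReal ≤ inner ℝ u x - (f x).toReal := by linarith
    rw [← hp.coe_toReal hy]
    exact_mod_cast h3
  · have : f y = ⊤ := by simpa [effDom] using hy
    simp [this]

lemma exists_submodule_of_zero_mem_intrinsicInterior {V : Type*} [NormedAddCommGroup V]
    [NormedSpace ℝ V] {C : Set V} (h : (0 : V) ∈ intrinsicInterior ℝ C) :
    ∃ S : Submodule ℝ V, C ⊆ S ∧ ∃ r > 0, ∀ v ∈ S, ‖v‖ < r → v ∈ C := by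
  obtain ⟨y, hy, hy0⟩ := mem_intrinsicInterior.1 h
  have h0 : (0 : V) ∈ affineSpan ℝ C := hy0 ▸ y.2
  have hmem : ∀ v : V, v ∈ (affineSpan ℝ C).direction ↔ v ∈ affineSpan ℝ C := fun v => by
    simpa using AffineSubspace.vsub_right_mem_direction_iff_mem h0 v
  obtain ⟨r, hr, hball⟩ := Metric.mem_nhds_iff.1 (mem_interior_iff_mem_nhds.1 hy)
  refine ⟨(affineSpan ℝ C).direction, fun v hv => (hmem v).2 (subset_affineSpan ℝ C hv), r, hr,
    fun v hv hvr => ?_⟩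
  have : (⟨v, (hmem v).1 hv⟩ : affineSpan ℝ C) ∈ Metric.ball y r := by
    rw [Metric.mem_ball, Subtype.dist_eq, hy0]
    simpa using hvr
  exact hball this

/-- A sequence in a subspace is bounded once its inner products with each vector of that subspace
are bounded above (a case of the Banach–Steinhaus theorem). -/
lemma exists_norm_le_of_inner_le {V : Type*} [NormedAddCommGroup V] [InnerProductSpace ℝ V]
    (S : Submodule ℝ V) [CompleteSpace S] {x : ℕ → V} (hxS : ∀ k, x k ∈ S)
    (h : ∀ v ∈ S, ∃ K : ℝ, ∀ k, inner ℝ v (x k) ≤ K) : ∃ C : ℝ, ∀ k, ‖x k‖ ≤ C := by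
  obtain ⟨C, hC⟩ := banach_steinhaus (g := fun k => (innerSL ℝ (x k)).comp S.subtypeL) (by
    intro v
    obtain ⟨K, hK⟩ := h v v.2
    obtain ⟨K', hK'⟩ := h (-v) (-v).2
    refine ⟨max K K', fun k => ?_⟩
    have h1 := hK k
    have h2 := hK' k
    rw [inner_neg_left] at h2
    simp only [ContinuousLinearMap.comp_apply, Submodule.subtypeL_apply, innerSL_apply_apply,
      Real.norm_eq_abs, real_inner_comm]
    exact abs_le.2 ⟨by linarith [le_max_right K K'], h1.trans (le_max_left _ _)⟩)
  refine ⟨C, fun k => ?_⟩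
  have h1 := ((innerSL ℝ (x k)).comp S.subtypeL).le_of_opNorm_le (hC k) ⟨x k, hxS k⟩
  simp only [ContinuousLinearMap.comp_apply, Submodule.subtypeL_apply, innerSL_apply_apply,
    real_inner_self_eq_norm_sq, norm_pow, norm_norm, Submodule.coe_norm] at h1
  rcases (norm_nonneg (x k)).eq_or_lt with h0 | h0
  · rw [← h0]
    exact (norm_nonneg _).trans (hC k)
  · exact le_of_mul_le_mul_right (by rwa [pow_two] at h1) h0

/-- Under the qualification condition the first update always exists. Minimizers of the
Tikhonov-regularized objectives lie, by Fermat's rule, in the subspace spanned by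
`dom f* - ran Mᵀ`; the qualification condition bounds them there, and any limit point is a
minimizer of the original objective. -/
theorem xUpdate_nonempty (hp : IsProper f) (hl : LowerSemicontinuous f)
    (hc : IsAlphaConvex α f) (hα : 0 ≤ α) (hγ : 0 < γ) {x₀ u₀ : E n}
    (h₀ : IsSubgradient α f x₀ u₀)
    (hQC : (0 : E n) ∈ intrinsicInterior ℝ
      (effDom (conj f) - Set.range (app M.transpose))) (z y : E m) :
    (xUpdate f M γ z y).Nonempty := by
  obtain ⟨S, hCS, r, hr, hSC⟩ := exists_submodule_of_zero_mem_intrinsicInterior hQC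
  set q : E n → ℝ := fun x => γ / 2 * ‖app M x - z + γ⁻¹ • y‖ ^ 2 with hq
  have hqc : Continuous q := by
    have := continuous_app M
    fun_prop
  have hq0 : ∀ x, 0 ≤ q x := fun x => by positivity
  let e : ℕ → ℝ := fun k => 1 / ((k : ℝ) + 1)
  have he : ∀ k, 0 < e k := fun k => Nat.one_div_pos_of_nat
  have he1 : ∀ k, e k ≤ 1 := fun k => by
    have : (0 : ℝ) ≤ k := Nat.cast_nonneg k
    exact (div_le_one (by linarith)).2 (by linarith)
  have hex : ∀ k, ∃ x, x ∈ argmin fun x => f x + ((q x + e k / 2 * ‖x‖ ^ 2 : ℝ) : EReal) :=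
    fun k => h₀.argmin_add_nonempty (κ := e k) (c := 0) hp hl (by fun_prop)
      (fun x => by simpa using hq0 x) (by linarith [he k])
  choose x hx using hex
  have hsub : ∀ k, IsSubgradient α f (x k)
      (-app M.transpose (y + γ • (app M (x k) - z)) - e k • x k) := by
    intro k
    refine hc.isSubgradient_of_mem_argmin hp (hx k) fun v =>
      ⟨γ / 2 * ‖app M v‖ ^ 2 + e k / 2 * ‖v‖ ^ 2, fun t => ?_⟩
    have h1 : ‖x k + t • v‖ ^ 2 = ‖x k‖ ^ 2 + 2 * (t * inner ℝ (x k) v) + t ^ 2 * ‖v‖ ^ 2 := by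
      rw [norm_add_sq_real, norm_smul, mul_pow, Real.norm_eq_abs, sq_abs, real_inner_smul_right]
    simp only [hq]
    rw [xPenalty_add_smul M hγ.ne', h1, inner_sub_left, inner_neg_left, real_inner_smul_left]
    linarith
  have hxS : ∀ k, x k ∈ S := by
    intro k
    have h1 : -(e k • x k) ∈ S := by
      refine hCS ⟨_, (hsub k).mem_effDom_conj hp hα, _,
        ⟨-(y + γ • (app M (x k) - z)), rfl⟩, ?_⟩
      simp only [map_neg]
      abel
    have h2 := S.smul_mem (-(e k)⁻¹) h1
    rwa [smul_neg, neg_smul, neg_neg, inv_smul_smul₀ (he k).ne'] at h2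
  have hmin : ∀ k, ∀ x' ∈ effDom f,
      (f (x k)).toReal + q (x k) ≤ (f x').toReal + q x' + e k / 2 * ‖x'‖ ^ 2 := by
    intro k x' hx'
    have h1 := (hp.mem_argmin_add_coe_iff.1 (hx k)).2 x' hx'
    have h2 : 0 ≤ e k / 2 * ‖x k‖ ^ 2 := by have := he k; positivity
    linarith
  obtain ⟨C, hC⟩ : ∃ C : ℝ, ∀ k, ‖x k‖ ≤ C := by
    refine exists_norm_le_of_inner_le S hxS fun v hv => ?_
    obtain ⟨s, hs, hsv⟩ : ∃ s : ℝ, 0 < s ∧ ‖s • v‖ < r := by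
      refine ⟨r / (‖v‖ + 1), by positivity, ?_⟩
      rw [norm_smul, Real.norm_of_nonneg (by positivity), div_mul_eq_mul_div,
        div_lt_iff₀ (by positivity)]
      nlinarith
    -- A multiple of `v` is `u - Mᵀ p` with `u ∈ dom f*`: the `u` part is controlled by the
    -- Fenchel–Young inequality, the `p` part by the penalty term `q`.
    obtain ⟨u, hu, _, ⟨p, rfl⟩, hup⟩ := hSC _ (S.smul_mem s hv) hsv
    obtain ⟨c, hc'⟩ := exists_inner_le_of_mem_effDom_conj hp hu
    set w := z - γ⁻¹ • y
    refine ⟨((f x₀).toReal + q x₀ + ‖x₀‖ ^ 2 + c + ‖p‖ ^ 2 / (2 * γ) + ‖p‖ * ‖w‖) / s,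
      fun k => ?_⟩
    rw [le_div_iff₀ hs]
    have h1 : inner ℝ v (x k) * s = inner ℝ u (x k) - inner ℝ p (app M (x k)) := by
      have h2 : s • v = u - app M.transpose p := hup.symm
      rw [← inner_app_transpose, ← inner_sub_left, ← h2, real_inner_smul_left, mul_comm]
    have h2 := hc' (x k) (hsub k).1
    have h3 := hmin k x₀ h₀.1
    have h4 : e k / 2 * ‖x₀‖ ^ 2 ≤ ‖x₀‖ ^ 2 := by
      have := he1 k
      nlinarith [sq_nonneg ‖x₀‖]
    have h5 : -inner ℝ p (app M (x k)) ≤ ‖p‖ * ‖app M (x k) - z + γ⁻¹ • y‖ + ‖p‖ * ‖w‖ := by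
      have h6 : app M (x k) = (app M (x k) - z + γ⁻¹ • y) + w := by simp only [w]; abel
      have h7 := (abs_le.1 (abs_real_inner_le_norm p (app M (x k) - z + γ⁻¹ • y))).1
      have h8 := (abs_le.1 (abs_real_inner_le_norm p w)).1
      rw [h6, inner_add_right, ← h6]
      linarith
    have h6 : ‖p‖ * ‖app M (x k) - z + γ⁻¹ • y‖ ≤ ‖p‖ ^ 2 / (2 * γ) + q (x k) := by
      have h7 : ‖p‖ ^ 2 / (2 * γ) + q (x k) - ‖p‖ * ‖app M (x k) - z + γ⁻¹ • y‖
          = (‖p‖ - γ * ‖app M (x k) - z + γ⁻¹ • y‖) ^ 2 / (2 * γ) := by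
        simp only [hq]
        field_simp
        ring
      have h8 : 0 ≤ (‖p‖ - γ * ‖app M (x k) - z + γ⁻¹ • y‖) ^ 2 / (2 * γ) := by positivity
      linarith
    linarith
  obtain ⟨a, -, φ, hφ, hlim⟩ := tendsto_subseq_of_bounded (Metric.isBounded_closedBall (x := 0))
    (fun k => mem_closedBall_zero_iff.2 (hC k))
  have hbound : ∀ x' ∈ effDom f, f a ≤ (((f x').toReal + q x' - q a : ℝ) : EReal) := by
    intro x' hx'
    have he0 : Tendsto (fun k => e (φ k)) atTop (𝓝 0) :=
      tendsto_one_div_add_atTop_nhds_zero_nat.comp hφ.tendsto_atTop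
    refine hl.le_of_tendsto hlim
      (r := fun k => (f x').toReal + q x' + e (φ k) / 2 * ‖x'‖ ^ 2 - q (x (φ k))) ?_ ?_
    · have h1 := ((he0.div_const 2).mul_const (‖x'‖ ^ 2)).const_add ((f x').toReal + q x')
      simpa using h1.sub ((hqc.tendsto a).comp hlim)
    · refine Eventually.of_forall fun k => ?_
      have := hmin (φ k) x' hx'
      simp only [Function.comp_apply]
      rw [← hp.coe_toReal (hsub (φ k)).1, EReal.coe_le_coe_iff]
      linarith
  have ha : a ∈ effDom f := lt_of_le_of_lt (hbound x₀ h₀.1) (EReal.coe_lt_top _)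
  refine ⟨a, hp.mem_argmin_add_coe_iff.2 ⟨ha, fun x' hx' => ?_⟩⟩
  have h1 := hbound x' hx'
  rw [← hp.coe_toReal ha, EReal.coe_le_coe_iff] at h1
  simp only [hq] at h1
  linarith

end Existence

/-! ### The energy inequality -/

/-- The quadratic form governing the decrease of the energy dominates a multiple of
`‖a - z‖ ^ 2`. This is where the admissible interval for `γ` comes from: the discriminant condition
is `(γ - η) ^ 2 < 2 * τ * η`. -/
lemma exists_mul_norm_sub_sq_le_form (V : Type*) [NormedAddCommGroup V] [InnerProductSpace ℝ V]
    {γ η τ : ℝ} (hη : 0 < η) (hτ : 0 ≤ τ) (h0 : τ = 0 → γ = η)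
    (h1 : 0 < τ → (γ - η) ^ 2 < 2 * τ * η) :
    ∃ c > 0, ∀ a z : V, c * ‖a - z‖ ^ 2 ≤
      (2 * γ + 2 * τ - η) * ‖a‖ ^ 2 - 2 * γ * inner ℝ a z + η * ‖z‖ ^ 2 := by
  rcases hτ.eq_or_lt with h | h
  · refine ⟨η, hη, fun a z => le_of_eq ?_⟩
    rw [norm_sub_sq_real, ← h, h0 h.symm]
    ring
  · -- With this constant the difference of the two sides is a single square.
    refine ⟨η - (γ - η) ^ 2 / (2 * τ), ?_, fun a z => ?_⟩
    · have := (div_lt_iff₀ (by positivity : 0 < 2 * τ)).2 (by linarith [h1 h] :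
        (γ - η) ^ 2 < η * (2 * τ))
      linarith
    · have h2 : 0 ≤ ‖(2 * τ + (γ - η)) • a - (γ - η) • z‖ ^ 2 / (2 * τ) := by positivity
      have h3 : (2 * γ + 2 * τ - η) * ‖a‖ ^ 2 - 2 * γ * inner ℝ a z + η * ‖z‖ ^ 2
          - (η - (γ - η) ^ 2 / (2 * τ)) * ‖a - z‖ ^ 2
          = ‖(2 * τ + (γ - η)) • a - (γ - η) • z‖ ^ 2 / (2 * τ) := by
        rw [norm_sub_sq_real, norm_sub_sq_real, norm_smul, norm_smul, mul_pow, mul_pow,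
          Real.norm_eq_abs, Real.norm_eq_abs, sq_abs, sq_abs, real_inner_smul_left,
          real_inner_smul_right]
        field_simp
        ring
      linarith

section Energy

variable {n m : ℕ} {f : E n → EReal} {g : E m → EReal} {M : Matrix (Fin m) (Fin n) ℝ}
  {α β γ δ : ℝ}

lemma IsSubgradient.monotone_transpose {x x' : E n} {p p' : E m}
    (h : IsSubgradient α f x (-app M.transpose p))
    (h' : IsSubgradient α f x' (-app M.transpose p')) :
    α * ‖x - x'‖ ^ 2 ≤ -inner ℝ (p - p') (app M x - app M x') := by
  have h1 := h.monotone h'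
  have h2 : -app M.transpose p - -app M.transpose p' = -app M.transpose (p - p') := by
    simp only [app, map_sub]
    abel
  have h3 : app M (x - x') = app M x - app M x' := by simp only [app, map_sub]
  rwa [h2, inner_neg_left, inner_app_transpose, h3] at h1

/-- Dependence of `z` on the shadow variable `u + δ • z` is Lipschitz, as for a resolvent. -/
lemma IsSubgradient.norm_sub_le {z z' u u' : E m} (h : IsSubgradient β g z u)
    (h' : IsSubgradient β g z' u') :
    (β + δ) * ‖z - z'‖ ≤ ‖(u + δ • z) - (u' + δ • z')‖ := by
  have h1 := h.monotone h'
  have h2 : inner ℝ ((u + δ • z) - (u' + δ • z')) (z - z')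
      = inner ℝ (u - u') (z - z') + δ * ‖z - z'‖ ^ 2 := by
    rw [show (u + δ • z) - (u' + δ • z') = (u - u') + δ • (z - z') by module, inner_add_left,
      real_inner_smul_left, real_inner_self_eq_norm_sq]
  have h3 := real_inner_le_norm ((u + δ • z) - (u' + δ • z')) (z - z')
  rcases (norm_nonneg (z - z')).eq_or_lt with h0 | h0
  · rw [← h0, mul_zero]
    positivity
  · refine le_of_mul_le_mul_right ?_ h0
    linarith [pow_two ‖z - z'‖]

/-- One step decreases the squared distance of the shadow variable `y + δ • z` to its value at a
critical point. -/
lemma norm_shadow_sub_sq_le (hM : 0 < ‖M‖) (hα : 0 ≤ α) (hδ : 0 < δ) {c : ℝ}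
    (hform : ∀ a z : E m, c * ‖a - z‖ ^ 2 ≤
      (2 * γ + 2 * (α / ‖M‖ ^ 2 + β) - (δ + 2 * β)) * ‖a‖ ^ 2 - 2 * γ * inner ℝ a z
        + (δ + 2 * β) * ‖z‖ ^ 2)
    {x xs : E n} {z y ys : E m}
    (hf : IsSubgradient α f x (-app M.transpose (y + γ • (app M x - z))))
    (hg : IsSubgradient β g z y)
    (hfs : IsSubgradient α f xs (-app M.transpose ys)) (hgs : IsSubgradient β g (app M xs) ys) :
    ‖(y + δ • app M x) - (ys + δ • app M xs)‖ ^ 2 ≤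
      ‖(y + δ • z) - (ys + δ • app M xs)‖ ^ 2 - δ * c * ‖app M x - z‖ ^ 2 := by
  set zs := app M xs with hzs
  have h1 := hf.monotone_transpose hfs
  have h2 := hg.monotone hgs
  have h3 : α / ‖M‖ ^ 2 * ‖app M x - zs‖ ^ 2 ≤ α * ‖x - xs‖ ^ 2 := by
    have h4 : app M (x - xs) = app M x - zs := by simp only [app, map_sub, hzs]
    have h5 := norm_app_le M (x - xs)
    rw [h4] at h5
    rw [div_mul_eq_mul_div, div_le_iff₀ (by positivity), mul_assoc]
    refine mul_le_mul_of_nonneg_left ?_ hα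
    rw [← mul_pow, mul_comm]
    exact pow_le_pow_left₀ (norm_nonneg _) h5 2
  have h4 := hform (app M x - zs) (z - zs)
  rw [← hzs] at h1
  obtain ⟨a, ha⟩ : ∃ a, a = app M x - zs := ⟨_, rfl⟩
  obtain ⟨b, hb⟩ : ∃ b, b = z - zs := ⟨_, rfl⟩
  obtain ⟨w, hw⟩ : ∃ w, w = y - ys := ⟨_, rfl⟩
  have e1 : app M x - z = a - b := by rw [ha, hb]; abel
  have e2 : (y + δ • app M x) - (ys + δ • zs) = w + δ • a := by rw [ha, hw]; module
  have e3 : (y + δ • z) - (ys + δ • zs) = w + δ • b := by rw [hb, hw]; module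
  have e4 : y + γ • (app M x - z) - ys = w + γ • (a - b) := by rw [e1, hw]; abel
  rw [e4, ← ha, inner_add_left, real_inner_smul_left, inner_sub_left,
    real_inner_self_eq_norm_sq, real_inner_comm a b] at h1
  rw [← hb, ← hw] at h2
  rw [← ha] at h3
  rw [← ha, ← hb] at h4
  rw [e1, e2, e3, norm_add_sq_real, norm_add_sq_real, norm_smul, norm_smul, mul_pow, mul_pow,
    Real.norm_eq_abs, sq_abs, real_inner_smul_right, real_inner_smul_right]
  have h5 : 0 ≤ δ * ((2 * (-(inner ℝ w a + γ * (‖a‖ ^ 2 - inner ℝ a b)) - α / ‖M‖ ^ 2 * ‖a‖ ^ 2)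
      + 2 * (inner ℝ w b - β * ‖b‖ ^ 2))
      + ((2 * γ + 2 * (α / ‖M‖ ^ 2 + β) - (δ + 2 * β)) * ‖a‖ ^ 2 - 2 * γ * inner ℝ a b
        + (δ + 2 * β) * ‖b‖ ^ 2 - c * ‖a - b‖ ^ 2)) := by
    refine mul_nonneg hδ.le (add_nonneg (add_nonneg ?_ ?_) ?_)
    all_goals linarith
  linarith

/-- Critical points give solutions: the quadratic terms of the two subgradient inequalities add
up to something nonnegative since `α + β * ‖M‖ ^ 2 ≥ 0`. -/
lemma isSolution_of_isSubgradient (hpf : IsProper f) (hpg : IsProper g) (hα : 0 ≤ α)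
    (hαβ : 0 ≤ α + β * ‖M‖ ^ 2) {x : E n} {y : E m}
    (hf : IsSubgradient α f x (-app M.transpose y)) (hg : IsSubgradient β g (app M x) y) :
    IsSolution f g M x (app M x) := by
  refine ⟨rfl, ?_⟩
  rintro x' _ rfl
  by_cases hx' : x' ∈ effDom f
  · by_cases hz' : app M x' ∈ effDom g
    · have h1 := hf.2 x' hx'
      have h2 := hg.2 _ hz'
      have h3 : app M (x' - x) = app M x' - app M x := by simp only [app, map_sub]
      rw [inner_neg_left, inner_app_transpose, h3] at h1
      have h4 := norm_app_le M (x' - x)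
      rw [h3] at h4
      have h5 : 0 ≤ α / 2 * ‖x' - x‖ ^ 2 + β / 2 * ‖app M x' - app M x‖ ^ 2 := by
        have h6 := pow_le_pow_left₀ (norm_nonneg _) h4 2
        rw [mul_pow] at h6
        rcases le_total 0 β with hβ | hβ
        · positivity
        · have h7 := mul_le_mul_of_nonpos_left h6 hβ
          have h8 := mul_nonneg hαβ (sq_nonneg ‖x' - x‖)
          linarith
      have h6 : (f x).toReal + (g (app M x)).toReal
          ≤ (f x').toReal + (g (app M x')).toReal := by linarith
      rw [← hpf.coe_toReal hf.1, ← hpf.coe_toReal hx', ← hpg.coe_toReal hg.1,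
        ← hpg.coe_toReal hz']
      exact_mod_cast h6
    · have : g (app M x') = ⊤ := by simpa [effDom] using hz'
      rw [this, EReal.add_top_of_ne_bot (hpf.1 x')]
      exact le_top
  · have : f x' = ⊤ := by simpa [effDom] using hx'
    rw [this, EReal.top_add_of_ne_bot (hpg.1 _)]
    exact le_top

end Energy

/-! ### Convergence of the iterates -/

lemma tendsto_zero_of_le_sub {D b : ℕ → ℝ} (hD : ∀ k, 0 ≤ D k) (hb : ∀ k, 0 ≤ b k)
    (h : ∀ k, D (k + 1) ≤ D k - b k) : Tendsto b atTop (𝓝 0) := by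
  have hanti : Antitone D := antitone_nat_of_succ_le fun k => by linarith [h k, hb k]
  have h1 := tendsto_atTop_ciInf hanti ⟨0, by rintro _ ⟨k, rfl⟩; exact hD k⟩
  have h2 := h1.sub ((tendsto_add_atTop_iff_nat 1).2 h1)
  rw [sub_self] at h2
  exact squeeze_zero hb (fun k => by linarith [h k]) h2

section Convergence

variable {n m : ℕ} {f : E n → EReal} {g : E m → EReal} {M : Matrix (Fin m) (Fin n) ℝ}
  {α β γ δ : ℝ}

/-- Convergence of sequences satisfying the optimality conditions of the iteration. The index is
chosen such that `z k` and `y k` already satisfy the optimality condition of the second update,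
and `x k` is the first update computed from them. -/
theorem exists_tendsto_of_isSubgradient (hM : 0 < ‖M‖) (hpf : IsProper f)
    (hcf : IsAlphaConvex α f) (hpg : IsProper g) (hlg : LowerSemicontinuous g)
    (hα : 0 ≤ α) (hγ : 0 < γ) (hδ : 0 < δ) (hβδ : 0 < β + δ)
    (hex : ∀ z y, (xUpdate f M γ z y).Nonempty) {c : ℝ} (hc : 0 < c)
    (hform : ∀ a z : E m, c * ‖a - z‖ ^ 2 ≤
      (2 * γ + 2 * (α / ‖M‖ ^ 2 + β) - (δ + 2 * β)) * ‖a‖ ^ 2 - 2 * γ * inner ℝ a z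
        + (δ + 2 * β) * ‖z‖ ^ 2)
    {xs : E n} {ys : E m} (hfs : IsSubgradient α f xs (-app M.transpose ys))
    (hgs : IsSubgradient β g (app M xs) ys)
    {x : ℕ → E n} {z y : ℕ → E m}
    (hf : ∀ k, IsSubgradient α f (x k) (-app M.transpose (y k + γ • (app M (x k) - z k))))
    (hg : ∀ k, IsSubgradient β g (z k) (y k))
    (hy : ∀ k, y (k + 1) = y k + δ • (app M (x k) - z (k + 1))) :
    ∃ xb yb, IsSubgradient α f xb (-app M.transpose yb) ∧ IsSubgradient β g (app M xb) yb ∧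
      Tendsto (fun k => app M (x k)) atTop (𝓝 (app M xb)) ∧
      Tendsto z atTop (𝓝 (app M xb)) ∧ Tendsto y atTop (𝓝 yb) := by
  -- Fejér monotonicity of the shadow sequence with respect to every critical point.
  have hfejer : ∀ {x' : E n} {y' : E m}, IsSubgradient α f x' (-app M.transpose y') →
      IsSubgradient β g (app M x') y' → ∀ k,
      ‖(y (k + 1) + δ • z (k + 1)) - (y' + δ • app M x')‖ ^ 2 ≤
        ‖(y k + δ • z k) - (y' + δ • app M x')‖ ^ 2 - δ * c * ‖app M (x k) - z k‖ ^ 2 := by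
    intro x' y' h1 h2 k
    rw [show y (k + 1) + δ • z (k + 1) = y k + δ • app M (x k) by rw [hy k]; module]
    exact norm_shadow_sub_sq_le hM hα hδ hform (hf k) (hg k) h1 h2
  have hanti : ∀ {x' : E n} {y' : E m}, IsSubgradient α f x' (-app M.transpose y') →
      IsSubgradient β g (app M x') y' →
      Antitone fun k => ‖(y k + δ • z k) - (y' + δ • app M x')‖ := fun h1 h2 =>
    antitone_nat_of_succ_le fun k => by
      refine pow_le_pow_iff_left₀ (norm_nonneg _) (norm_nonneg _) two_ne_zero |>.1 ?_
      have h3 : 0 ≤ δ * c * ‖app M (x k) - z k‖ ^ 2 := by positivity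
      linarith [hfejer h1 h2 k]
  have hres : Tendsto (fun k => app M (x k) - z k) atTop (𝓝 0) := by
    have h1 := (tendsto_zero_of_le_sub
      (D := fun k => ‖(y k + δ • z k) - (ys + δ • app M xs)‖ ^ 2)
      (b := fun k => δ * c * ‖app M (x k) - z k‖ ^ 2) (fun k => by positivity)
      (fun k => by positivity) (hfejer hfs hgs)).const_mul (δ * c)⁻¹
    have h2 : Tendsto (fun k => ‖app M (x k) - z k‖ ^ 2) atTop (𝓝 0) := by
      simpa only [inv_mul_cancel_left₀ (mul_pos hδ hc).ne', mul_zero] using h1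
    have h3 := h2.sqrt
    simp only [Real.sqrt_sq (norm_nonneg _), Real.sqrt_zero] at h3
    exact tendsto_zero_iff_norm_tendsto_zero.2 h3
  obtain ⟨⟨zb, yb⟩, φ, hφ, hlim⟩ : ∃ (p : E m × E m) (φ : ℕ → ℕ),
      StrictMono φ ∧ Tendsto ((fun k => (z k, y k)) ∘ φ) atTop (𝓝 p) := by
    set B := ‖(y 0 + δ • z 0) - (ys + δ • app M xs)‖
    have hB : ∀ k, ‖(y k + δ • z k) - (ys + δ • app M xs)‖ ≤ B :=
      fun k => hanti hfs hgs (Nat.zero_le k)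
    have hz : ∀ k, ‖z k - app M xs‖ ≤ B / (β + δ) := fun k => by
      rw [le_div_iff₀ hβδ, mul_comm]
      exact ((hg k).norm_sub_le hgs).trans (hB k)
    have hy' : ∀ k, ‖y k - ys‖ ≤ B + δ * (B / (β + δ)) := fun k => by
      rw [show y k - ys = ((y k + δ • z k) - (ys + δ • app M xs)) - δ • (z k - app M xs) by module]
      refine (norm_sub_le _ _).trans (add_le_add (hB k) ?_)
      rw [norm_smul, Real.norm_of_nonneg hδ.le]
      exact mul_le_mul_of_nonneg_left (hz k) hδ.le
    obtain ⟨p, -, φ, hφ, hlim⟩ := tendsto_subseq_of_bounded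
      ((Metric.isBounded_closedBall (x := app M xs) (r := B / (β + δ))).prod
        (Metric.isBounded_closedBall (x := ys) (r := B + δ * (B / (β + δ)))))
      (x := fun k => (z k, y k))
      (fun k => ⟨mem_closedBall_iff_norm.2 (hz k), mem_closedBall_iff_norm.2 (hy' k)⟩)
    exact ⟨p, φ, hφ, hlim⟩
  have hzφ : Tendsto (fun k => z (φ k)) atTop (𝓝 zb) := (Prod.tendsto_iff _ _).1 hlim |>.1
  have hyφ : Tendsto (fun k => y (φ k)) atTop (𝓝 yb) := (Prod.tendsto_iff _ _).1 hlim |>.2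
  have hrφ := hres.comp hφ.tendsto_atTop
  have haφ : Tendsto (fun k => app M (x (φ k))) atTop (𝓝 zb) := by
    simpa using hrφ.add hzφ
  have hgb : IsSubgradient β g zb yb :=
    IsSubgradient.of_tendsto hpg hlg hzφ hyφ (Eventually.of_forall fun k => hg (φ k))
  -- The sequence `x` may be unbounded; a primal point is supplied by the first update at the
  -- cluster point, and monotonicity forces it to be feasible.
  obtain ⟨xb, hxb⟩ := hex zb yb
  have hfb := isSubgradient_of_mem_xUpdate hpf hcf hγ.ne' hxb
  have hfeas : app M xb = zb := by
    have h1 : ∀ k, 0 ≤ -inner ℝ (y (φ k) + γ • (app M (x (φ k)) - z (φ k))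
        - (yb + γ • (app M xb - zb))) (app M (x (φ k)) - app M xb) := fun k =>
      le_trans (by positivity) ((hf (φ k)).monotone_transpose hfb)
    have h2 : Tendsto (fun k => -inner ℝ (y (φ k) + γ • (app M (x (φ k)) - z (φ k))
        - (yb + γ • (app M xb - zb))) (app M (x (φ k)) - app M xb)) atTop
        (𝓝 (-inner ℝ (yb + γ • (0 : E m) - (yb + γ • (app M xb - zb))) (zb - app M xb))) :=
      (((hyφ.add (hrφ.const_smul γ)).sub_const _).inner (haφ.sub_const _)).neg
    have h3 := ge_of_tendsto' h2 h1
    rw [show yb + γ • (0 : E m) - (yb + γ • (app M xb - zb)) = γ • (zb - app M xb) by module,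
      real_inner_smul_left, real_inner_self_eq_norm_sq] at h3
    have h4 : ‖zb - app M xb‖ ^ 2 = 0 := by nlinarith [sq_nonneg ‖zb - app M xb‖]
    exact (sub_eq_zero.1 (norm_eq_zero.1 (pow_eq_zero_iff two_ne_zero |>.1 h4))).symm
  rw [hfeas, sub_self, smul_zero, add_zero] at hfb
  rw [← hfeas] at hgb hzφ haφ
  have hw : Tendsto (fun k => ‖(y k + δ • z k) - (yb + δ • app M xb)‖) atTop (𝓝 0) := by
    refine (tendsto_iff_tendsto_subseq_of_antitone (hanti hfb hgb) hφ.tendsto_atTop).2 ?_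
    have := ((hyφ.add (hzφ.const_smul δ)).sub_const (yb + δ • app M xb)).norm
    simpa [Function.comp_def] using this
  have hz : Tendsto z atTop (𝓝 (app M xb)) := by
    refine tendsto_iff_norm_sub_tendsto_zero.2 (squeeze_zero (fun k => norm_nonneg _)
      (fun k => ?_) (by simpa using hw.div_const (β + δ)))
    rw [le_div_iff₀ hβδ, mul_comm]
    exact (hg k).norm_sub_le hgb
  refine ⟨xb, yb, hfb, hgb, by simpa using hres.add hz, hz, ?_⟩
  have h1 := (tendsto_zero_iff_norm_tendsto_zero.2 hw).sub ((hz.sub_const (app M xb)).const_smul δ)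
  rw [sub_self, smul_zero, sub_zero] at h1
  refine tendsto_sub_nhds_zero_iff.1 (h1.congr fun k => ?_)
  module

end Convergence

/-- The admissible interval for `γ` in terms of the discriminant of the energy form. -/
lemma sq_lt_of_mem_Ioo_halfWidth {n m : ℕ} {M : Matrix (Fin m) (Fin n) ℝ} {α β γ δ : ℝ}
    (hM : 0 < ‖M‖) (hαβ : 0 < α + β * ‖M‖ ^ 2) (hη : 0 < δ + 2 * β)
    (h : γ ∈ Set.Ioo (max 0 (δ + 2 * β - halfWidth M α β δ)) (δ + 2 * β + halfWidth M α β δ)) :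
    (γ - (δ + 2 * β)) ^ 2 < 2 * (α / ‖M‖ ^ 2 + β) * (δ + 2 * β) := by
  have h1 := (le_max_right _ _).trans_lt h.1
  have h2 := h.2
  have h3 : |γ - (δ + 2 * β)| < halfWidth M α β δ := abs_lt.2 ⟨by linarith, by linarith⟩
  have h4 := pow_lt_pow_left₀ h3 (abs_nonneg _) two_ne_zero
  rw [sq_abs, halfWidth, mul_pow, Real.sq_sqrt (by positivity)] at h4
  refine h4.trans_eq ?_
  field_simp

end AADMM

theorem mainTheorem1 {n m : ℕ} (M : Matrix (Fin m) (Fin n) ℝ) (hM : M ≠ 0)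
    (f : AADMM.E n → EReal) (g : AADMM.E m → EReal) (α β : ℝ)
    (hf_proper : AADMM.IsProper f) (hf_lsc : LowerSemicontinuous f)
    (hf_conv : AADMM.IsAlphaConvex α f)
    (hg_proper : AADMM.IsProper g) (hg_lsc : LowerSemicontinuous g)
    (hg_conv : AADMM.IsAlphaConvex β g)
    (hα : 0 ≤ α) (hαβ : 0 ≤ α + β * ‖M‖ ^ 2)
    (hcrit : ∃ x z y, AADMM.IsCriticalPoint f g M x z y)
    (hQC : (0 : AADMM.E n) ∈ intrinsicInterior ℝ
      (AADMM.effDom (AADMM.conj f) - Set.range (AADMM.app M.transpose)))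
    (γ δ : ℝ) (hδ : max 0 (-2 * β) < δ)
    (hγ_eq : α + β * ‖M‖ ^ 2 = 0 → γ = δ + 2 * β)
    (hγ_pos : 0 < α + β * ‖M‖ ^ 2 →
      γ ∈ Set.Ioo (max 0 (δ + 2 * β - AADMM.halfWidth M α β δ))
        (δ + 2 * β + AADMM.halfWidth M α β δ)) :
    (∀ z y, (AADMM.xUpdate f M γ z y).Nonempty) ∧
    (∀ x y, ∃! z, z ∈ AADMM.zUpdate g M δ x y) ∧
    ∀ (x : ℕ → AADMM.E n) (z y : ℕ → AADMM.E m), AADMM.IsAADMM f g M γ δ x z y →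
      ∃ xs zs ys, AADMM.IsCriticalPoint f g M xs zs ys ∧
        AADMM.IsSolution f g M xs zs ∧
        Filter.Tendsto (fun k => AADMM.app M (x k)) Filter.atTop (nhds (AADMM.app M xs)) ∧
        Filter.Tendsto z Filter.atTop (nhds zs) ∧
        Filter.Tendsto y Filter.atTop (nhds ys) := by
  have hMn : 0 < ‖M‖ := norm_pos_iff.2 hM
  have hδ0 : 0 < δ := (le_max_left _ _).trans_lt hδ
  have hη : 0 < δ + 2 * β := by linarith [(le_max_right 0 (-2 * β)).trans_lt hδ]
  have hβδ : 0 < β + δ := by linarith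
  have hτeq : α + β * ‖M‖ ^ 2 = (α / ‖M‖ ^ 2 + β) * ‖M‖ ^ 2 := by field_simp
  have hτ : 0 ≤ α / ‖M‖ ^ 2 + β :=
    nonneg_of_mul_nonneg_left (hτeq ▸ hαβ) (by positivity)
  have hγ : 0 < γ := by
    rcases hαβ.eq_or_lt with h | h
    · rw [hγ_eq h.symm]
      exact hη
    · exact (le_max_left _ _).trans_lt (hγ_pos h).1
  obtain ⟨c, hc, hform⟩ := AADMM.exists_mul_norm_sub_sq_le_form (AADMM.E m) hη hτ
    (fun h => hγ_eq (by rw [hτeq, h, zero_mul])) (fun h => by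
      have h1 : 0 < α + β * ‖M‖ ^ 2 := by rw [hτeq]; positivity
      exact AADMM.sq_lt_of_mem_Ioo_halfWidth hMn h1 hη (hγ_pos h1))
  obtain ⟨xs, zs, ys, hcf, hcg, hfeas⟩ := hcrit
  obtain rfl : AADMM.app M xs = zs := sub_eq_zero.1 hfeas
  rw [hf_conv.mem_subdiff_iff hf_proper hα] at hcf
  rw [hg_conv.mem_frechetSubdiff_iff hg_proper] at hcg
  have hex : ∀ z y, (AADMM.xUpdate f M γ z y).Nonempty :=
    AADMM.xUpdate_nonempty hf_proper hf_lsc hf_conv hα hγ hcf hQC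
  refine ⟨hex,
    AADMM.existsUnique_zUpdate hg_proper hg_lsc hg_conv hδ0.ne' hβδ hcg, fun x z y hit => ?_⟩
  obtain ⟨xb, yb, hfb, hgb, hx, hz, hy⟩ := AADMM.exists_tendsto_of_isSubgradient hMn hf_proper
    hf_conv hg_proper hg_lsc hα hγ hδ0 hβδ hex hc hform hcf hcg
    (x := fun k => x (k + 2)) (z := fun k => z (k + 1)) (y := fun k => y (k + 1))
    (fun k => AADMM.isSubgradient_of_mem_xUpdate hf_proper hf_conv hγ.ne' (hit (k + 1)).1)
    (fun k => by
      rw [(hit k).2.2]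
      exact AADMM.isSubgradient_of_mem_zUpdate hg_proper hg_conv hδ0.ne' (hit k).2.1)
    (fun k => (hit (k + 1)).2.2)
  exact ⟨xb, AADMM.app M xb, yb, ⟨(hf_conv.mem_subdiff_iff hf_proper hα).2 hfb,
      (hg_conv.mem_frechetSubdiff_iff hg_proper).2 hgb, sub_self _⟩,
    AADMM.isSolution_of_isSubgradient hf_proper hg_proper hα hαβ hfb hgb,
    (Filter.tendsto_add_atTop_iff_nat 2).1 hx, (Filter.tendsto_add_atTop_iff_nat 1).1 hz,
    (Filter.tendsto_add_atTop_iff_nat 1).1 hy⟩
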